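/- The equation $$\frac{x}{2}(1+x)^{3/2}(3+x)\left[1+(1+x)^{3/2}\right]=1$$ has exactly one positive solution $\delta_1$, and $0.203701<\delta_1<0.203702$. For every real $\delta$ with $0<\delta<\delta_1$, the problem $$[(1+\delta y(x))\,y'(x)]'+2x\,y'(x)=0\quad (0<x<+\infty),\qquad y(0)=0,\qquad \lim_{x\to+\infty}y(x)=1,$$ has exactly one solution $y:[0,+\infty)\to\mathbb{R}$ that is non-negative and analytic on $[0,+\infty)$ (at the end point $0$, analytic means that $y$ is given by a convergent power series on some interval $[0,r)$, $r>0$). -/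

import Mathlib

open Set Filter Topology

noncomputable section

/-- The function `x ↦ (x/2) (1+x)^{3/2} (3+x) [1 + (1+x)^{3/2}]`. -/
def thresholdFun (x : ℝ) : ℝ :=
  x / 2 * (1 + x) ^ (3 / 2 : ℝ) * (3 + x) * (1 + (1 + x) ^ (3 / 2 : ℝ))

/-- `y` (of which only the values on `[0, ∞)` matter) is a classical solution of
`[(1 + δ y) y']' + 2 x y' = 0` on `(0, ∞)`, `y(0) = 0`, `y(+∞) = 1`. -/
structure IsChoSunderlandSolution (δ : ℝ) (y : ℝ → ℝ) : Prop where
  continuousOn : ContinuousOn y (Ici 0)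
  differentiableAt : ∀ x : ℝ, 0 < x → DifferentiableAt ℝ y x
  flux_differentiableAt : ∀ x : ℝ, 0 < x →
    DifferentiableAt ℝ (fun t => (1 + δ * y t) * deriv y t) x
  ode : ∀ x : ℝ, 0 < x →
    deriv (fun t => (1 + δ * y t) * deriv y t) x + 2 * x * deriv y x = 0
  at_zero : y 0 = 0
  at_infty : Tendsto y atTop (𝓝 1)

/-- A non-negative solution that is analytic on the closed half-line `[0, ∞)`
(at the end point `0`: given by a convergent power series on some `[0, r)`). -/
structure IsModifiedErrorFunction (δ : ℝ) (y : ℝ → ℝ) : Prop where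
  solution : IsChoSunderlandSolution δ y
  nonneg : ∀ x : ℝ, 0 ≤ x → 0 ≤ y x
  analyticOn : AnalyticOn ℝ y (Ici 0)

end

/-! Freezing the coefficient as `1 + δ * h` makes the equation linear, and an integrating factor
solves it: the flux is a multiple of `exp (-potential)`, so the solution is the normalized primitive
`linearizedSolution δ h` of `density δ h`. Solutions of the original problem are the fixed points of
this map on continuous functions with values in `[0, 1]`. Gaussian bounds on `density` show that the
map is Lipschitz with constant at most `thresholdFun δ` (`abs_linearizedSolution_sub_le`). As
`thresholdFun` increases, the constant is below 1 when `δ < δ₁`, and Banach's theorem applies.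
Conversely a non-negative solution is monotone, hence at most 1, hence a fixed point
(`linearizedSolution_eq`). For analyticity up to 0, `p = 1 / (1 + δ y)` and the flux `w` solve a
polynomial system. Rescaled to `[0, 1]`, it becomes a fixed point equation in a Banach space, to
which the analytic implicit function theorem applies, even for one-sided increments. -/

/-! ### The threshold equation and its root. -/

theorem thresholdFun_strictMonoOn : StrictMonoOn thresholdFun (Ici 0) := by
  intro a ha b hb hab
  have ha0 : (0 : ℝ) ≤ a := ha
  have hs : (1 + a) ^ (3 / 2 : ℝ) < (1 + b) ^ (3 / 2 : ℝ) :=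
    Real.rpow_lt_rpow (by linarith) (by linarith) (by norm_num)
  have hp : 0 < (1 + a) ^ (3 / 2 : ℝ) := Real.rpow_pos_of_pos (by linarith) _
  have hb0 : 0 < b := lt_of_le_of_lt ha0 hab
  unfold thresholdFun
  have hp' := hp.trans hs
  gcongr

theorem continuousOn_thresholdFun : ContinuousOn thresholdFun (Ici 0) := by
  have h : ContinuousOn (fun x : ℝ => (1 + x) ^ (3 / 2 : ℝ)) (Ici 0) :=
    ContinuousOn.rpow_const (by fun_prop) fun x _ => Or.inr (by norm_num)
  unfold thresholdFun
  fun_prop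

/-- Reduces numerical bounds on the power 3/2 to comparing rational squares and cubes. -/
theorem rpow_three_halves_nonneg_sq {a : ℝ} (ha : 0 ≤ a) :
    0 ≤ a ^ (3 / 2 : ℝ) ∧ (a ^ (3 / 2 : ℝ)) ^ 2 = a ^ 3 := by
  refine ⟨Real.rpow_nonneg ha _, ?_⟩
  rw [← Real.rpow_natCast, ← Real.rpow_mul ha, ← Real.rpow_natCast]
  norm_num

theorem thresholdFun_lower_lt_one : thresholdFun 0.203701 < 1 := by
  obtain ⟨h0, h2⟩ := rpow_three_halves_nonneg_sq (a := 1 + 0.203701) (by norm_num)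
  unfold thresholdFun
  have h : (1 + 0.203701 : ℝ) ^ (3 / 2 : ℝ) < 1.320621 := by
    refine lt_of_pow_lt_pow_left₀ 2 (by norm_num) ?_
    rw [h2]; norm_num
  nlinarith

theorem one_lt_thresholdFun_upper : 1 < thresholdFun 0.203702 := by
  obtain ⟨h0, h2⟩ := rpow_three_halves_nonneg_sq (a := 1 + 0.203702) (by norm_num)
  unfold thresholdFun
  have h : 1.3206217 < (1 + 0.203702 : ℝ) ^ (3 / 2 : ℝ) := by
    refine lt_of_pow_lt_pow_left₀ 2 h0 ?_
    rw [h2]; norm_num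
  nlinarith

theorem exists_thresholdFun_eq_one :
    ∃ d : ℝ, thresholdFun d = 1 ∧ 0.203701 < d ∧ d < 0.203702 := by
  obtain ⟨d, hd, h1⟩ := intermediate_value_Ioo (f := thresholdFun)
    (show (0.203701 : ℝ) ≤ 0.203702 by norm_num)
    (continuousOn_thresholdFun.mono fun x hx => le_trans (by norm_num) hx.1)
    ⟨thresholdFun_lower_lt_one, one_lt_thresholdFun_upper⟩
  exact ⟨d, h1, hd⟩

/-! ### Analyticity up to the end point. -/

/-- A continuous branch `b` of solutions of the fixed point equation `v = b 0 + ε • N (ε, v)` with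
`N` analytic agrees near `0` with an analytic function. -/
theorem exists_analyticAt_eventuallyEq_of_fixedPoint {B : Type*} [NormedAddCommGroup B]
    [NormedSpace ℝ B] [CompleteSpace B] {N : ℝ × B → B} {b : ℝ → B} {s : Set ℝ}
    (hN : AnalyticAt ℝ N (0, b 0)) (hb : Tendsto b (𝓝[s] 0) (𝓝 (b 0)))
    (heq : ∀ ε ∈ s, b ε = b 0 + ε • N (ε, b ε)) :
    ∃ g : ℝ → B, AnalyticAt ℝ g 0 ∧ b =ᶠ[𝓝[s] 0] g := by
  have hf : AnalyticAt ℝ (fun v : ℝ × B => v.2 - v.1 • N v) (0, b 0) :=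
    analyticAt_snd.sub (analyticAt_fst.smul hN)
  set f : ℝ × B → B := fun v => v.2 - v.1 • N v with hfdef
  have hc : ContDiffAt ℝ ⊤ f (0, b 0) := hf.contDiffAt
  -- At `ε = 0` the map is `v ↦ v`, so its partial derivative in `v` is the identity.
  have hd : fderiv ℝ f (0, b 0) ∘L .inr ℝ ℝ B = .id ℝ B := by
    have h1 : HasFDerivAt (fun v : B => ((0 : ℝ), v)) (.inr ℝ ℝ B) (b 0) :=
      hasFDerivAt_prodMk_right 0 (b 0)
    have h2 := (hc.differentiableAt (by simp)).hasFDerivAt.comp (b 0) h1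
    have h3 : f ∘ (fun v : B => ((0 : ℝ), v)) = id := by
      ext v; simp [hfdef]
    rw [h3] at h2
    exact h2.unique (hasFDerivAt_id _)
  have hi : (fderiv ℝ f (0, b 0) ∘L .inr ℝ ℝ B).IsInvertible := by
    rw [hd]; exact ⟨.refl ℝ B, rfl⟩
  have htop : (⊤ : WithTop ℕ∞) ≠ 0 := by simp
  refine ⟨hc.implicitFunction htop hi, (hc.contDiffAt_implicitFunction htop hi).analyticAt, ?_⟩
  have ht : Tendsto (fun ε : ℝ => (ε, b ε)) (𝓝[s] 0) (𝓝 (0, b 0)) :=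
    (tendsto_id.mono_left nhdsWithin_le_nhds).prodMk_nhds hb
  filter_upwards [ht.eventually (hc.eventually_apply_eq_iff_implicitFunction htop hi),
    self_mem_nhdsWithin] with ε h1 hε
  refine (h1.1 ?_).symm
  simp only [hfdef, zero_smul, sub_zero]
  rw [sub_eq_iff_eq_add]
  exact heq ε hε

noncomputable section

/-- The primitive vanishing at `0` of a continuous function on the unit interval. -/
def primitiveMap (f : C(unitInterval, ℝ)) : C(unitInterval, ℝ) where
  toFun s := ∫ t in (0 : ℝ)..s, f (projIcc 0 1 zero_le_one t)
  continuous_toFun := by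
    have h : Continuous fun t : ℝ => f (projIcc 0 1 zero_le_one t) :=
      f.continuous.comp continuous_projIcc
    exact (intervalIntegral.continuous_primitive (fun a b => h.intervalIntegrable a b) 0).comp
      continuous_subtype_val

/-- `primitiveMap` as a continuous linear map. -/
def primitiveCLM : C(unitInterval, ℝ) →L[ℝ] C(unitInterval, ℝ) :=
  LinearMap.mkContinuous
    { toFun := primitiveMap
      map_add' := fun f g => by
        ext s
        simp only [primitiveMap, ContinuousMap.coe_mk, ContinuousMap.add_apply]
        exact intervalIntegral.integral_add
          ((f.continuous.comp continuous_projIcc).intervalIntegrable _ _)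
          ((g.continuous.comp continuous_projIcc).intervalIntegrable _ _)
      map_smul' := fun c f => by
        ext s
        simp [primitiveMap] } 1 (by
    intro f
    rw [one_mul, ContinuousMap.norm_le _ (norm_nonneg f)]
    intro s
    refine (intervalIntegral.norm_integral_le_of_norm_le_const
      (C := ‖f‖) fun t _ => f.norm_coe_le_norm _).trans ?_
    rw [sub_zero, abs_of_nonneg s.2.1]
    exact mul_le_of_le_one_right (norm_nonneg f) s.2.2)

theorem primitiveCLM_apply (f : C(unitInterval, ℝ)) (s : unitInterval) :
    primitiveCLM f s = ∫ t in (0 : ℝ)..s, f (projIcc 0 1 zero_le_one t) := rfl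

/-- The restriction of `q` to the segment from `a` to `a + ε`, parametrized by the unit interval. -/
def segmentMap (q : C(ℝ, ℝ)) (a ε : ℝ) : C(unitInterval, ℝ) :=
  ⟨fun s => q (a + ε * s), by fun_prop⟩

theorem continuous_segmentMap (q : C(ℝ, ℝ)) (a : ℝ) : Continuous (segmentMap q a) :=
  ContinuousMap.continuous_of_continuous_uncurry _ (by
    change Continuous fun x : ℝ × unitInterval => q (a + x.1 * x.2)
    fun_prop)

/-- The fundamental theorem of calculus, rescaled. It needs the derivative only inside the segment,
so either end may be 0. -/
theorem segmentMap_eq_add_smul_primitiveCLM {q q' : C(ℝ, ℝ)}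
    (hq : ∀ x, 0 < x → HasDerivAt q (q' x) x) {a ε : ℝ} (ha : 0 ≤ a) (haε : 0 ≤ a + ε) :
    segmentMap q a ε = segmentMap q a 0 + ε • primitiveCLM (segmentMap q' a ε) := by
  ext s
  simp only [ContinuousMap.add_apply, ContinuousMap.smul_apply, primitiveCLM_apply]
  rcases eq_or_ne ε 0 with rfl | hε
  · simp
  have hpos : ∀ t ∈ Ioo (0 : ℝ) s, 0 < a + ε * t := by
    intro t ht
    have ht1 : t < 1 := ht.2.trans_le s.2.2
    rcases lt_or_gt_of_ne hε with h | h
    · nlinarith [ht.1]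
    · nlinarith [ht.1, mul_pos h ht.1]
  have hcont : Continuous fun t : ℝ => ε * q' (a + ε * t) := by fun_prop
  have key := intervalIntegral.integral_eq_sub_of_hasDerivAt_of_le (a := 0) (b := s)
    (f := fun t : ℝ => q (a + ε * t)) (f' := fun t => ε * q' (a + ε * t)) s.2.1
    (by fun_prop) (fun t ht => by
      have h1 : HasDerivAt (fun t : ℝ => a + ε * t) ε t := by
        simpa using ((hasDerivAt_id t).const_mul ε).const_add a
      have := (hq _ (hpos t ht)).comp t h1
      rwa [mul_comm] at this) (hcont.intervalIntegrable _ _)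
  have hcongr : ∫ t in (0 : ℝ)..s, (segmentMap q' a ε) (projIcc 0 1 zero_le_one t)
      = ∫ t in (0 : ℝ)..s, q' (a + ε * t) := by
    refine intervalIntegral.integral_congr fun t ht => ?_
    rw [uIcc_of_le s.2.1] at ht
    have : t ∈ Icc (0 : ℝ) 1 := ⟨ht.1, ht.2.trans s.2.2⟩
    simp [segmentMap, projIcc_of_mem zero_le_one this]
  rw [hcongr, smul_eq_mul, ← intervalIntegral.integral_const_mul, key]
  simp [segmentMap]

/-- Solutions on the half line of the system `p' = -δ w p³`, `w' = -2 x w p` are analytic up to the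
end point. -/
theorem analyticOn_of_hasDerivAt {δ : ℝ} {p w : C(ℝ, ℝ)}
    (hp : ∀ x, 0 < x → HasDerivAt p (-δ * (w x * p x ^ 3)) x)
    (hw : ∀ x, 0 < x → HasDerivAt w (-2 * (x * w x * p x)) x) :
    AnalyticOn ℝ p (Ici 0) := by
  intro a ha
  have ha0 : (0 : ℝ) ≤ a := ha
  let p' : C(ℝ, ℝ) := ⟨fun x => -δ * (w x * p x ^ 3), by fun_prop⟩
  let w' : C(ℝ, ℝ) := ⟨fun x => -2 * (x * w x * p x), by fun_prop⟩
  let S : C(unitInterval, ℝ) := ⟨fun s => (s : ℝ), by fun_prop⟩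
  let A : C(unitInterval, ℝ) := ContinuousMap.const _ a
  let N : ℝ × (C(unitInterval, ℝ) × C(unitInterval, ℝ)) →
      C(unitInterval, ℝ) × C(unitInterval, ℝ) := fun v =>
    (primitiveCLM (-δ • (v.2.2 * v.2.1 ^ 3)),
      primitiveCLM ((-2 : ℝ) • ((A + v.1 • S) * v.2.2 * v.2.1)))
  let b : ℝ → C(unitInterval, ℝ) × C(unitInterval, ℝ) := fun ε =>
    (segmentMap p a ε, segmentMap w a ε)
  have hN : AnalyticAt ℝ N (0, b 0) := by
    have e1 : AnalyticAt ℝ (fun v : ℝ × (C(unitInterval, ℝ) × C(unitInterval, ℝ)) => v.2.1)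
      (0, b 0) := analyticAt_fst.comp analyticAt_snd
    have e2 : AnalyticAt ℝ (fun v : ℝ × (C(unitInterval, ℝ) × C(unitInterval, ℝ)) => v.2.2)
      (0, b 0) := analyticAt_snd.comp analyticAt_snd
    refine AnalyticAt.prod ?_ ?_
    · exact (primitiveCLM.analyticAt _).comp (analyticAt_const.fun_smul (e2.fun_mul (e1.fun_pow 3)))
    · exact (primitiveCLM.analyticAt _).comp (analyticAt_const.fun_smul
        (((analyticAt_const.fun_add (analyticAt_fst.fun_smul analyticAt_const)).fun_mul e2).fun_mul
          e1))
  -- The admissible increments form a neighbourhood of 0 if `a > 0`, and a half-line if `a = 0`.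
  have hb : Tendsto b (𝓝[{ε | 0 ≤ a + ε}] 0) (𝓝 (b 0)) :=
    (((continuous_segmentMap p a).prodMk (continuous_segmentMap w a)).tendsto 0).mono_left
      nhdsWithin_le_nhds
  have heq : ∀ ε ∈ {ε | 0 ≤ a + ε}, b ε = b 0 + ε • N (ε, b ε) := by
    intro ε hε
    refine Prod.ext ?_ ?_
    · exact segmentMap_eq_add_smul_primitiveCLM (q' := p') hp ha0 hε
    · exact segmentMap_eq_add_smul_primitiveCLM (q' := w') hw ha0 hε
  obtain ⟨g, hg, hbg⟩ := exists_analyticAt_eventuallyEq_of_fixedPoint hN hb heq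
  rw [analyticWithinAt_iff_exists_analyticAt]
  -- The value of `p` at `x` is read off at the end `s = 1` of the segment from `a` to `x`.
  refine ⟨fun x => (g (x - a)).1 1, ?_, ?_⟩
  · have ht : Tendsto (fun x : ℝ => x - a) (𝓝[insert a (Ici 0)] a) (𝓝[{ε | 0 ≤ a + ε}] 0) := by
      refine tendsto_nhdsWithin_iff.2 ⟨?_, ?_⟩
      · have : Tendsto (fun x : ℝ => x - a) (𝓝 a) (𝓝 (a - a)) :=
          (continuous_id.sub continuous_const).tendsto a
        rw [sub_self] at this
        exact this.mono_left nhdsWithin_le_nhds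
      · rw [insert_eq_of_mem ha]
        filter_upwards [self_mem_nhdsWithin] with x hx
        simpa using hx
    filter_upwards [ht.eventually hbg] with x hx
    rw [← hx]
    simp [b, segmentMap]
  · have h0 : AnalyticAt ℝ g (a - a) := by rwa [sub_self]
    have h1 : AnalyticAt ℝ (fun x : ℝ => g (x - a)) a :=
      h0.comp (f := fun x : ℝ => x - a) (analyticAt_id.sub analyticAt_const)
    have h2 := (((ContinuousMap.evalCLM ℝ (1 : unitInterval)).comp
      (ContinuousLinearMap.fst ℝ C(unitInterval, ℝ) C(unitInterval, ℝ))).analyticAt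
        (g (a - a))).comp (f := fun x : ℝ => g (x - a)) h1
    exact h2

end
-- The linearized problem.
open MeasureTheory

noncomputable section

/-- The exponent `∫₀ˣ 2t / (1 + δ h(t)) dt` of the integrating factor. -/
def potential (δ : ℝ) (h : ℝ → ℝ) (x : ℝ) : ℝ := ∫ t in (0 : ℝ)..x, 2 * t / (1 + δ * h t)

/-- The derivative, up to normalization, of the solution of the problem linearized at `h`. -/
def density (δ : ℝ) (h : ℝ → ℝ) (x : ℝ) : ℝ := Real.exp (-potential δ h x) / (1 + δ * h x)

/-- The total mass of `density δ h` on the half line. -/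
def mass (δ : ℝ) (h : ℝ → ℝ) : ℝ := ∫ x in Ioi (0 : ℝ), density δ h x

/-- The solution of the problem linearized at `h`, extended by `0` to the negative half line. -/
def linearizedSolution (δ : ℝ) (h : ℝ → ℝ) (x : ℝ) : ℝ :=
  (∫ t in (0 : ℝ)..max x 0, density δ h t) / mass δ h

section Bounds

variable {δ : ℝ} {h : ℝ → ℝ}

theorem one_le_conductivity (hδ : 0 < δ) (h0 : ∀ x, 0 ≤ h x) (x : ℝ) :
    1 ≤ 1 + δ * h x := by
  nlinarith [h0 x]

theorem conductivity_le (hδ : 0 < δ) (hI : ∀ x, h x ∈ Icc (0 : ℝ) 1) (x : ℝ) :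
    1 + δ * h x ≤ 1 + δ := by
  nlinarith [(hI x).2]

theorem continuous_potential_integrand (hδ : 0 < δ) (hc : Continuous h)
    (h0 : ∀ x, 0 ≤ h x) : Continuous fun t : ℝ => 2 * t / (1 + δ * h t) :=
  Continuous.div (by fun_prop) (by fun_prop) fun x => by linarith [one_le_conductivity hδ h0 x]

theorem hasDerivAt_potential (hδ : 0 < δ) (hc : Continuous h)
    (h0 : ∀ x, 0 ≤ h x) (x : ℝ) :
    HasDerivAt (potential δ h) (2 * x / (1 + δ * h x)) x :=
  (continuous_potential_integrand hδ hc h0).integral_hasStrictDerivAt 0 x |>.hasDerivAt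

theorem continuous_potential (hδ : 0 < δ) (hc : Continuous h)
    (h0 : ∀ x, 0 ≤ h x) : Continuous (potential δ h) :=
  continuous_iff_continuousAt.2 fun x => (hasDerivAt_potential hδ hc h0 x).continuousAt

theorem continuous_density (hδ : 0 < δ) (hc : Continuous h)
    (h0 : ∀ x, 0 ≤ h x) : Continuous (density δ h) := by
  have := continuous_potential hδ hc h0
  exact Continuous.div (by fun_prop) (by fun_prop) fun x => by
    linarith [one_le_conductivity hδ h0 x]

theorem density_pos (hδ : 0 < δ) (h0 : ∀ x, 0 ≤ h x) (x : ℝ) : 0 < density δ h x :=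
  div_pos (Real.exp_pos _) (by linarith [one_le_conductivity hδ h0 x])

theorem integral_two_mul (c x : ℝ) : ∫ t in (0 : ℝ)..x, c * (2 * t) = c * x ^ 2 := by
  rw [intervalIntegral.integral_const_mul, intervalIntegral.integral_const_mul, integral_id]
  ring

/-- The coefficient lies between 1 and `1 + δ`, which will trap `density` between two Gaussians: the
upper one gives integrability, the lower one a positive lower bound for `mass`. -/
theorem le_potential (hδ : 0 < δ) (hc : Continuous h) (hI : ∀ x, h x ∈ Icc (0 : ℝ) 1) {x : ℝ}
    (hx : 0 ≤ x) : (1 + δ)⁻¹ * x ^ 2 ≤ potential δ h x := by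
  rw [← integral_two_mul]
  refine intervalIntegral.integral_mono_on hx
    ((by fun_prop : Continuous fun t : ℝ => (1 + δ)⁻¹ * (2 * t)).intervalIntegrable _ _)
    ((continuous_potential_integrand hδ hc (fun y => (hI y).1)).intervalIntegrable _ _)
    fun t ht => ?_
  have h1 := one_le_conductivity hδ (fun y => (hI y).1) t
  rw [inv_mul_eq_div]
  exact div_le_div_of_nonneg_left (by linarith [ht.1]) (by linarith) (conductivity_le hδ hI t)

theorem potential_le (hδ : 0 < δ) (hc : Continuous h) (hI : ∀ x, h x ∈ Icc (0 : ℝ) 1) {x : ℝ}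
    (hx : 0 ≤ x) : potential δ h x ≤ x ^ 2 := by
  rw [← one_mul (x ^ 2), ← integral_two_mul]
  refine intervalIntegral.integral_mono_on hx
    ((continuous_potential_integrand hδ hc (fun y => (hI y).1)).intervalIntegrable _ _)
    ((by fun_prop : Continuous fun t : ℝ => 1 * (2 * t)).intervalIntegrable _ _)
    fun t ht => ?_
  rw [one_mul]
  exact div_le_self (by linarith [ht.1]) (one_le_conductivity hδ (fun y => (hI y).1) t)

theorem density_le (hδ : 0 < δ) (hc : Continuous h) (hI : ∀ x, h x ∈ Icc (0 : ℝ) 1) {x : ℝ}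
    (hx : 0 ≤ x) : density δ h x ≤ Real.exp (-(1 + δ)⁻¹ * x ^ 2) := by
  refine (div_le_self (Real.exp_pos _).le (one_le_conductivity hδ (fun y => (hI y).1) x)).trans ?_
  have := le_potential hδ hc hI hx
  exact Real.exp_le_exp.2 (by linarith)

theorem le_density (hδ : 0 < δ) (hc : Continuous h) (hI : ∀ x, h x ∈ Icc (0 : ℝ) 1) {x : ℝ}
    (hx : 0 ≤ x) : (1 + δ)⁻¹ * Real.exp (-1 * x ^ 2) ≤ density δ h x := by
  have h1 := one_le_conductivity hδ (fun y => (hI y).1) x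
  rw [inv_mul_eq_div]
  refine div_le_div₀ (Real.exp_pos _).le (Real.exp_le_exp.2 ?_) (by linarith)
    (conductivity_le hδ hI x)
  linarith [potential_le hδ hc hI hx]

theorem integrableOn_density (hδ : 0 < δ) (hc : Continuous h) (hI : ∀ x, h x ∈ Icc (0 : ℝ) 1) :
    IntegrableOn (density δ h) (Ioi 0) := by
  refine Integrable.mono' (g := fun x : ℝ => Real.exp (-(1 + δ)⁻¹ * x ^ 2))
    (integrable_exp_neg_mul_sq (by positivity)).integrableOn
    (continuous_density hδ hc (fun y => (hI y).1)).aestronglyMeasurable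
    ((ae_restrict_mem measurableSet_Ioi).mono fun x hx => ?_)
  rw [Real.norm_of_nonneg (density_pos hδ (fun y => (hI y).1) x).le]
  exact density_le hδ hc hI (le_of_lt hx)

theorem le_mass (hδ : 0 < δ) (hc : Continuous h) (hI : ∀ x, h x ∈ Icc (0 : ℝ) 1) :
    (1 + δ)⁻¹ * (√Real.pi / 2) ≤ mass δ h := by
  have h1 := integral_gaussian_Ioi 1
  rw [div_one] at h1
  rw [← h1, ← integral_const_mul]
  exact setIntegral_mono_on ((integrable_exp_neg_mul_sq one_pos).integrableOn.const_mul _)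
    (integrableOn_density hδ hc hI) measurableSet_Ioi
    fun x hx => le_density hδ hc hI (le_of_lt hx)

theorem mass_pos (hδ : 0 < δ) (hc : Continuous h) (hI : ∀ x, h x ∈ Icc (0 : ℝ) 1) :
    0 < mass δ h :=
  lt_of_lt_of_le (by positivity) (le_mass hδ hc hI)

theorem integral_density_mem (hδ : 0 < δ) (hc : Continuous h) (hI : ∀ x, h x ∈ Icc (0 : ℝ) 1)
    {x : ℝ} (hx : 0 ≤ x) : (∫ t in (0 : ℝ)..x, density δ h t) ∈ Icc 0 (mass δ h) := by
  rw [intervalIntegral.integral_of_le hx]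
  exact ⟨integral_nonneg fun t => (density_pos hδ (fun y => (hI y).1) t).le,
    setIntegral_mono_set (integrableOn_density hδ hc hI)
      (Eventually.of_forall fun t => (density_pos hδ (fun y => (hI y).1) t).le)
      (Eventually.of_forall fun t ht => ht.1)⟩

theorem continuous_linearizedSolution (hδ : 0 < δ) (hc : Continuous h)
    (hI : ∀ x, h x ∈ Icc (0 : ℝ) 1) : Continuous (linearizedSolution δ h) := by
  have h1 : Continuous fun x => ∫ t in (0 : ℝ)..x, density δ h t :=
    intervalIntegral.continuous_primitive
      (fun a b => (continuous_density hδ hc (fun y => (hI y).1)).intervalIntegrable a b) 0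
  exact (h1.comp (by fun_prop : Continuous fun x : ℝ => max x 0)).div_const _

theorem linearizedSolution_mem (hδ : 0 < δ) (hc : Continuous h)
    (hI : ∀ x, h x ∈ Icc (0 : ℝ) 1) (x : ℝ) : linearizedSolution δ h x ∈ Icc (0 : ℝ) 1 := by
  have h1 := integral_density_mem hδ hc hI (le_max_right x 0)
  have hm := mass_pos hδ hc hI
  exact ⟨div_nonneg h1.1 hm.le, (div_le_one hm).2 h1.2⟩

theorem linearizedSolution_zero : linearizedSolution δ h 0 = 0 := by
  simp [linearizedSolution]

theorem hasDerivAt_linearizedSolution (hδ : 0 < δ) (hc : Continuous h)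
    (hI : ∀ x, h x ∈ Icc (0 : ℝ) 1) {x : ℝ} (hx : 0 < x) :
    HasDerivAt (linearizedSolution δ h) (density δ h x / mass δ h) x := by
  have h1 : HasDerivAt (fun y => (∫ t in (0 : ℝ)..y, density δ h t) / mass δ h)
      (density δ h x / mass δ h) x :=
    ((continuous_density hδ hc (fun y => (hI y).1)).integral_hasStrictDerivAt 0
      x).hasDerivAt.div_const _
  refine h1.congr_of_eventuallyEq ?_
  filter_upwards [lt_mem_nhds hx] with y hy
  simp [linearizedSolution, max_eq_left hy.le]

theorem tendsto_linearizedSolution (hδ : 0 < δ) (hc : Continuous h)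
    (hI : ∀ x, h x ∈ Icc (0 : ℝ) 1) : Tendsto (linearizedSolution δ h) atTop (𝓝 1) := by
  have h1 : Tendsto (fun y => (∫ t in (0 : ℝ)..y, density δ h t) / mass δ h) atTop
      (𝓝 (mass δ h / mass δ h)) :=
    (intervalIntegral_tendsto_integral_Ioi 0 (integrableOn_density hδ hc hI)
      tendsto_id).div_const _
  rw [div_self (mass_pos hδ hc hI).ne'] at h1
  refine h1.congr' ?_
  filter_upwards [eventually_ge_atTop 0] with y hy
  simp [linearizedSolution, max_eq_left hy]

end Bounds

/-! ### The contraction estimate. -/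

theorem integral_sq_mul_exp_neg_mul_sq {b : ℝ} (hb : 0 < b) :
    IntegrableOn (fun x : ℝ => x ^ 2 * Real.exp (-b * x ^ 2)) (Ioi 0) ∧
    ∫ x in Ioi (0 : ℝ), x ^ 2 * Real.exp (-b * x ^ 2) = √(Real.pi / b) / (4 * b) := by
  constructor
  · have := integrableOn_rpow_mul_exp_neg_mul_sq hb (s := 2) (by norm_num)
    simpa using this
  have := integral_rpow_mul_exp_neg_mul_rpow (p := 2) (q := 2) (b := b) (by norm_num)
    (by norm_num) hb
  simp only [Real.rpow_two] at this
  rw [this, show ((2 : ℝ) + 1) / 2 = 1 / 2 + 1 by norm_num, Real.Gamma_add_one (by norm_num),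
    Real.Gamma_one_half_eq, show -((2 : ℝ) + 1) / 2 = -(1 / 2) + -1 by norm_num,
    Real.rpow_add hb, Real.rpow_neg hb.le, Real.rpow_neg_one, ← Real.sqrt_eq_rpow,
    Real.sqrt_div Real.pi_pos.le]
  have := Real.sqrt_pos.2 hb
  field_simp
  norm_num

section Contraction

variable {δ M : ℝ} {h k : ℝ → ℝ}

theorem abs_inv_sub_inv_le {a b : ℝ} (ha : 1 ≤ a) (hb : 1 ≤ b) : |a⁻¹ - b⁻¹| ≤ |a - b| := by
  have ha0 : 0 < a := by linarith
  have hb0 : 0 < b := by linarith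
  rw [inv_sub_inv ha0.ne' hb0.ne', abs_div, abs_sub_comm, abs_of_pos (mul_pos ha0 hb0)]
  exact div_le_self (abs_nonneg _) (by nlinarith)

theorem abs_exp_neg_sub_exp_neg_le {a b m : ℝ} (ha : m ≤ a) (hb : m ≤ b) :
    |Real.exp (-a) - Real.exp (-b)| ≤ |a - b| * Real.exp (-m) := by
  wlog hab : a ≤ b generalizing a b
  · rw [abs_sub_comm, abs_sub_comm a]
    exact this hb ha (le_of_not_ge hab)
  have h1 : Real.exp (-b) ≤ Real.exp (-a) := Real.exp_le_exp.2 (by linarith)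
  rw [abs_of_nonneg (by linarith), abs_of_nonpos (by linarith)]
  have h2 : Real.exp (-b) = Real.exp (-a) * Real.exp (a - b) := by
    rw [← Real.exp_add]; congr 1; ring
  have h3 := Real.add_one_le_exp (a - b)
  have h4 : Real.exp (-a) ≤ Real.exp (-m) := Real.exp_le_exp.2 (by linarith)
  have h5 := Real.exp_pos (-a)
  nlinarith

theorem abs_inv_conductivity_sub_le (hδ : 0 < δ) (hI : ∀ x, h x ∈ Icc (0 : ℝ) 1)
    (kI : ∀ x, k x ∈ Icc (0 : ℝ) 1) (hM : ∀ x, |h x - k x| ≤ M) (x : ℝ) :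
    |(1 + δ * h x)⁻¹ - (1 + δ * k x)⁻¹| ≤ δ * M := by
  refine (abs_inv_sub_inv_le (one_le_conductivity hδ (fun y => (hI y).1) x)
    (one_le_conductivity hδ (fun y => (kI y).1) x)).trans ?_
  rw [show 1 + δ * h x - (1 + δ * k x) = δ * (h x - k x) by ring, abs_mul, abs_of_pos hδ]
  exact mul_le_mul_of_nonneg_left (hM x) hδ.le

theorem abs_potential_sub_le (hδ : 0 < δ) (hc : Continuous h) (kc : Continuous k)
    (hI : ∀ x, h x ∈ Icc (0 : ℝ) 1) (kI : ∀ x, k x ∈ Icc (0 : ℝ) 1)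
    (hM : ∀ x, |h x - k x| ≤ M) {x : ℝ} (hx : 0 ≤ x) :
    |potential δ h x - potential δ k x| ≤ δ * M * x ^ 2 := by
  unfold potential
  rw [← intervalIntegral.integral_sub
    ((continuous_potential_integrand hδ hc (fun y => (hI y).1)).intervalIntegrable _ _)
    ((continuous_potential_integrand hδ kc (fun y => (kI y).1)).intervalIntegrable _ _),
    ← integral_two_mul]
  rw [← Real.norm_eq_abs]
  refine intervalIntegral.norm_integral_le_of_norm_le hx
    (ae_of_all _ fun t ht => ?_)
    ((by fun_prop : Continuous fun t : ℝ => δ * M * (2 * t)).intervalIntegrable _ _)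
  rw [Real.norm_eq_abs, div_eq_mul_inv, div_eq_mul_inv, ← mul_sub, abs_mul,
    abs_of_nonneg (by linarith [ht.1] : (0 : ℝ) ≤ 2 * t), mul_comm (δ * M)]
  exact mul_le_mul_of_nonneg_left (abs_inv_conductivity_sub_le hδ hI kI hM t) (by linarith [ht.1])

/-- Varying the prefactor gives the plain Gaussian; varying the exponent gives the term with `x ^
2`. -/
theorem abs_density_sub_le (hδ : 0 < δ) (hc : Continuous h) (kc : Continuous k)
    (hI : ∀ x, h x ∈ Icc (0 : ℝ) 1) (kI : ∀ x, k x ∈ Icc (0 : ℝ) 1)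
    (hM : ∀ x, |h x - k x| ≤ M) {x : ℝ} (hx : 0 ≤ x) :
    |density δ h x - density δ k x| ≤
      δ * M * (Real.exp (-(1 + δ)⁻¹ * x ^ 2) + x ^ 2 * Real.exp (-(1 + δ)⁻¹ * x ^ 2)) := by
  have hA := one_le_conductivity hδ (fun y => (hI y).1) x
  have hA1 : (1 + δ * h x)⁻¹ ≤ 1 := inv_le_one_of_one_le₀ hA
  have hA0 : 0 < (1 + δ * h x)⁻¹ := by positivity
  have e1 := abs_exp_neg_sub_exp_neg_le (le_potential hδ hc hI hx) (le_potential hδ kc kI hx)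
  rw [← neg_mul] at e1
  have e2 := abs_potential_sub_le hδ hc kc hI kI hM hx
  have e3 := abs_inv_conductivity_sub_le hδ hI kI hM x
  have e4 : Real.exp (-potential δ k x) ≤ Real.exp (-(1 + δ)⁻¹ * x ^ 2) :=
    Real.exp_le_exp.2 (by linarith [le_potential hδ kc kI hx])
  have hE := Real.exp_pos (-(1 + δ)⁻¹ * x ^ 2)
  set E := Real.exp (-(1 + δ)⁻¹ * x ^ 2)
  unfold density
  rw [show Real.exp (-potential δ h x) / (1 + δ * h x) - Real.exp (-potential δ k x) / (1 + δ * k x)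
    = (Real.exp (-potential δ h x) - Real.exp (-potential δ k x)) * (1 + δ * h x)⁻¹
      + Real.exp (-potential δ k x) * ((1 + δ * h x)⁻¹ - (1 + δ * k x)⁻¹) by ring]
  refine (abs_add_le _ _).trans ?_
  rw [abs_mul, abs_mul, abs_of_pos hA0, Real.abs_exp]
  have f1 : |Real.exp (-potential δ h x) - Real.exp (-potential δ k x)| * (1 + δ * h x)⁻¹
      ≤ δ * M * x ^ 2 * E :=
    (mul_le_of_le_one_right (abs_nonneg _) hA1).trans
      (e1.trans (mul_le_mul_of_nonneg_right e2 hE.le))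
  have f2 : Real.exp (-potential δ k x) * |(1 + δ * h x)⁻¹ - (1 + δ * k x)⁻¹| ≤ E * (δ * M) :=
    mul_le_mul e4 e3 (abs_nonneg _) hE.le
  linarith

/-- With `b = (1 + δ)⁻¹`, the zeroth and second Gaussian moments are `√(π (1 + δ))` times `1 / 2`
and `(1 + δ) / 4`; these sum to `(3 + δ) / 4`. -/
theorem setIntegral_abs_density_sub_le (hδ : 0 < δ) (hc : Continuous h) (kc : Continuous k)
    (hI : ∀ x, h x ∈ Icc (0 : ℝ) 1) (kI : ∀ x, k x ∈ Icc (0 : ℝ) 1)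
    (hM : ∀ x, |h x - k x| ≤ M) :
    ∫ x in Ioi (0 : ℝ), |density δ h x - density δ k x| ≤
      δ * M * (√Real.pi * √(1 + δ) * (3 + δ) / 4) := by
  have hb : 0 < (1 + δ)⁻¹ := by positivity
  obtain ⟨i1, i2⟩ := integral_sq_mul_exp_neg_mul_sq hb
  have j1 : IntegrableOn (fun x : ℝ => Real.exp (-(1 + δ)⁻¹ * x ^ 2)) (Ioi 0) :=
    (integrable_exp_neg_mul_sq hb).integrableOn
  have j2 := integral_gaussian_Ioi (1 + δ)⁻¹
  have j3 : IntegrableOn (fun x : ℝ => Real.exp (-(1 + δ)⁻¹ * x ^ 2)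
      + x ^ 2 * Real.exp (-(1 + δ)⁻¹ * x ^ 2)) (Ioi 0) := Integrable.add j1 i1
  calc ∫ x in Ioi (0 : ℝ), |density δ h x - density δ k x|
      ≤ ∫ x in Ioi (0 : ℝ), δ * M * (Real.exp (-(1 + δ)⁻¹ * x ^ 2)
          + x ^ 2 * Real.exp (-(1 + δ)⁻¹ * x ^ 2)) :=
        setIntegral_mono_on ((integrableOn_density hδ hc hI).sub (integrableOn_density hδ kc kI)).abs
          (Integrable.const_mul j3 _) measurableSet_Ioi
          fun x hx => abs_density_sub_le hδ hc kc hI kI hM (le_of_lt hx)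
    _ = δ * M * (√Real.pi * √(1 + δ) * (3 + δ) / 4) := by
        rw [integral_const_mul, integral_add j1 i1, i2, j2, div_inv_eq_mul,
          Real.sqrt_mul Real.pi_pos.le]
        field_simp
        ring

theorem abs_linearizedSolution_sub_le (hδ : 0 < δ) (hc : Continuous h) (kc : Continuous k)
    (hI : ∀ x, h x ∈ Icc (0 : ℝ) 1) (kI : ∀ x, k x ∈ Icc (0 : ℝ) 1)
    (hM : ∀ x, |h x - k x| ≤ M) (x : ℝ) :
    |linearizedSolution δ h x - linearizedSolution δ k x| ≤ thresholdFun δ * M := by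
  have hM0 : 0 ≤ M := (abs_nonneg _).trans (hM 0)
  have hG := mass_pos hδ hc hI
  have kG := mass_pos hδ kc kI
  have hx : 0 ≤ max x 0 := le_max_right _ _
  have kJ := integral_density_mem hδ kc kI hx
  have hint : IntegrableOn (fun t => density δ h t - density δ k t) (Ioi 0) :=
    (integrableOn_density hδ hc hI).sub (integrableOn_density hδ kc kI)
  have hD := setIntegral_abs_density_sub_le hδ hc kc hI kI hM
  have hI1 : |(∫ t in (0 : ℝ)..max x 0, density δ h t) - ∫ t in (0 : ℝ)..max x 0, density δ k t|
      ≤ δ * M * (√Real.pi * √(1 + δ) * (3 + δ) / 4) := by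
    rw [← intervalIntegral.integral_sub
      ((continuous_density hδ hc (fun y => (hI y).1)).intervalIntegrable _ _)
      ((continuous_density hδ kc (fun y => (kI y).1)).intervalIntegrable _ _),
      intervalIntegral.integral_of_le hx]
    refine (abs_integral_le_integral_abs).trans (le_trans ?_ hD)
    exact setIntegral_mono_set hint.abs (Eventually.of_forall fun t => abs_nonneg _)
      (Eventually.of_forall fun t ht => ht.1)
  have hG1 : |mass δ k - mass δ h| ≤ δ * M * (√Real.pi * √(1 + δ) * (3 + δ) / 4) := by
    rw [abs_sub_comm]
    unfold mass
    rw [← integral_sub (integrableOn_density hδ hc hI) (integrableOn_density hδ kc kI)]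
    exact abs_integral_le_integral_abs.trans hD
  have hlow := le_mass hδ hc hI
  unfold linearizedSolution
  set I₁ := ∫ t in (0 : ℝ)..max x 0, density δ h t
  set I₂ := ∫ t in (0 : ℝ)..max x 0, density δ k t
  set D := δ * M * (√Real.pi * √(1 + δ) * (3 + δ) / 4) with hDdef
  -- The ratio `I₂ / mass δ k` lies in `[0, 1]`, so the numerator is at most twice the `L¹` distance
  -- bound `D`.
  have hsplit : I₁ / mass δ h - I₂ / mass δ k =
      ((I₁ - I₂) + I₂ / mass δ k * (mass δ k - mass δ h)) / mass δ h := by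
    field_simp
    ring
  have hr0 : 0 ≤ I₂ / mass δ k := div_nonneg kJ.1 kG.le
  have hr1 : I₂ / mass δ k ≤ 1 := (div_le_one kG).2 kJ.2
  rw [hsplit, abs_div, abs_of_pos hG, div_le_iff₀ hG]
  have hnum : |(I₁ - I₂) + I₂ / mass δ k * (mass δ k - mass δ h)| ≤ 2 * D := by
    refine (abs_add_le _ _).trans ?_
    rw [abs_mul, abs_of_nonneg hr0]
    have := mul_le_of_le_one_left (abs_nonneg (mass δ k - mass δ h)) hr1
    linarith
  refine hnum.trans ?_
  have hs1 : 1 ≤ √(1 + δ) := Real.one_le_sqrt.2 (by linarith)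
  have hpow : (1 + δ) ^ (3 / 2 : ℝ) = (1 + δ) * √(1 + δ) := by
    rw [show (3 / 2 : ℝ) = 1 + 1 / 2 by norm_num, Real.rpow_add (by linarith), Real.rpow_one,
      Real.sqrt_eq_rpow]
  have hpow1 : 1 ≤ (1 + δ) * √(1 + δ) := by nlinarith
  -- The left side is the Lipschitz constant obtained here; `thresholdFun` has the extra factor `(1
  -- + (1 + δ) ^ (3 / 2)) / 2 ≥ 1`.
  have hT : δ * ((1 + δ) * √(1 + δ)) * (3 + δ) ≤ thresholdFun δ := by
    unfold thresholdFun
    rw [hpow]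
    have : 0 ≤ δ / 2 * ((1 + δ) * √(1 + δ)) * (3 + δ) := by positivity
    nlinarith
  calc 2 * D = δ * ((1 + δ) * √(1 + δ)) * (3 + δ) * M * ((1 + δ)⁻¹ * (√Real.pi / 2)) := by
        rw [hDdef]; field_simp; ring
    _ ≤ thresholdFun δ * M * mass δ h := by
        refine mul_le_mul (mul_le_mul_of_nonneg_right hT hM0) hlow (by positivity) ?_
        exact mul_nonneg (le_trans (by positivity) hT) hM0

end Contraction

end

/-! ### Every solution is a fixed point. -/

section Uniqueness

variable {δ : ℝ} {z : ℝ → ℝ}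

/-- A solution is constrained only on `[0, ∞)`; composing with `max x 0` gives the globally
continuous function that the linearized problem needs. -/
theorem IsModifiedErrorFunction.continuous_comp_max (hz : IsModifiedErrorFunction δ z) :
    Continuous fun x => z (max x 0) :=
  hz.solution.continuousOn.comp_continuous (by fun_prop) fun x => le_max_right x 0

theorem IsModifiedErrorFunction.comp_max_nonneg (hz : IsModifiedErrorFunction δ z) (x : ℝ) :
    0 ≤ z (max x 0) :=
  hz.nonneg _ (le_max_right x 0)

/-- By the equation, the flux times `exp (potential)` has zero derivative. -/
theorem IsModifiedErrorFunction.exists_deriv_eq (hδ : 0 < δ) (hz : IsModifiedErrorFunction δ z) :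
    ∃ c : ℝ, ∀ x, 0 < x → deriv z x = c * density δ (fun x => z (max x 0)) x := by
  set h : ℝ → ℝ := fun x => z (max x 0) with hh
  have hzh : ∀ x, 0 < x → h x = z x := fun x hx => by simp [hh, max_eq_left hx.le]
  have hA : ∀ x, 1 ≤ 1 + δ * h x := one_le_conductivity hδ hz.comp_max_nonneg
  have hd : ∀ x, 0 < x → HasDerivAt
      (fun t => (1 + δ * z t) * deriv z t * Real.exp (potential δ h t)) 0 x := by
    intro x hx
    have h1 := (hz.solution.flux_differentiableAt x hx).hasDerivAt
    have h2 := (hasDerivAt_potential hδ hz.continuous_comp_max hz.comp_max_nonneg x).exp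
    refine (h1.mul h2).congr_deriv ?_
    have hode := hz.solution.ode x hx
    have hAx := hA x
    rw [← eq_neg_iff_add_eq_zero] at hode
    rw [hode]
    change _ * Real.exp (potential δ h x) + _ * (Real.exp (potential δ h x)
      * (2 * x / (1 + δ * h x))) = 0
    rw [hzh x hx] at hAx ⊢
    field_simp
    ring
  obtain ⟨c, hc⟩ := isOpen_Ioi.exists_is_const_of_deriv_eq_zero isPreconnected_Ioi
    (fun x hx => (hd x hx).differentiableAt.differentiableWithinAt) (fun x hx => (hd x hx).deriv)
  refine ⟨c, fun x hx => ?_⟩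
  have hcx := hc x hx
  have hAx := hA x
  unfold density
  rw [hzh x hx] at hAx ⊢
  rw [← hcx, Real.exp_neg]
  have := Real.exp_pos (potential δ h x)
  field_simp

theorem IsModifiedErrorFunction.exists_eq_integral (hδ : 0 < δ)
    (hz : IsModifiedErrorFunction δ z) :
    ∃ c : ℝ, ∀ x, 0 ≤ x → z x = c * ∫ t in (0 : ℝ)..x, density δ (fun x => z (max x 0)) t := by
  obtain ⟨c, hc⟩ := hz.exists_deriv_eq hδ
  refine ⟨c, fun x hx => ?_⟩
  have hcont := continuous_density hδ hz.continuous_comp_max hz.comp_max_nonneg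
  have key := intervalIntegral.integral_eq_sub_of_hasDerivAt_of_le (a := 0) (b := x) (f := z)
    (f' := fun t => c * density δ (fun x => z (max x 0)) t) hx
    (hz.solution.continuousOn.mono Icc_subset_Ici_self)
    (fun t ht => by
      have h1 := (hz.solution.differentiableAt t ht.1).hasDerivAt
      rwa [hc t ht.1] at h1)
    ((continuous_const.mul hcont).intervalIntegrable _ _)
  rw [intervalIntegral.integral_const_mul, hz.solution.at_zero, sub_zero] at key
  exact key.symm

/-- The solution is `c` times a nondecreasing integral, and `c < 0` would contradict the limit 1. So
it is nondecreasing and bounded by its limit. -/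
theorem IsModifiedErrorFunction.le_one (hδ : 0 < δ) (hz : IsModifiedErrorFunction δ z) {x : ℝ}
    (hx : 0 ≤ x) : z x ≤ 1 := by
  obtain ⟨c, hc⟩ := hz.exists_eq_integral hδ
  have hcont := continuous_density hδ hz.continuous_comp_max hz.comp_max_nonneg
  have hpos := density_pos hδ hz.comp_max_nonneg
  have hnn : ∀ a b : ℝ, a ≤ b → 0 ≤ ∫ t in a..b, density δ (fun x => z (max x 0)) t :=
    fun a b hab => intervalIntegral.integral_nonneg hab fun t _ => (hpos t).le
  have hc0 : 0 ≤ c := by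
    by_contra! hneg
    have h1 : ∀ᶠ y in atTop, z y ≤ 0 := by
      filter_upwards [eventually_ge_atTop 0] with y hy
      rw [hc y hy]
      exact mul_nonpos_of_nonpos_of_nonneg hneg.le (hnn 0 y hy)
    linarith [le_of_tendsto hz.solution.at_infty h1]
  refine ge_of_tendsto hz.solution.at_infty ?_
  filter_upwards [eventually_ge_atTop x] with y hy
  rw [hc x hx, hc y (hx.trans hy), ← intervalIntegral.integral_add_adjacent_intervals
    (hcont.intervalIntegrable 0 x) (hcont.intervalIntegrable x y)]
  exact mul_le_mul_of_nonneg_left (by linarith [hnn x y hy]) hc0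

theorem IsModifiedErrorFunction.comp_max_mem (hδ : 0 < δ) (hz : IsModifiedErrorFunction δ z)
    (x : ℝ) : z (max x 0) ∈ Icc (0 : ℝ) 1 :=
  ⟨hz.comp_max_nonneg x, hz.le_one hδ (le_max_right x 0)⟩

theorem IsModifiedErrorFunction.linearizedSolution_eq (hδ : 0 < δ)
    (hz : IsModifiedErrorFunction δ z) (x : ℝ) :
    linearizedSolution δ (fun x => z (max x 0)) x = z (max x 0) := by
  obtain ⟨c, hc⟩ := hz.exists_eq_integral hδ
  have hI := hz.comp_max_mem hδ
  have hm := mass_pos hδ hz.continuous_comp_max hI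
  have h1 : Tendsto (fun x => c * ∫ t in (0 : ℝ)..x, density δ (fun x => z (max x 0)) t) atTop
      (𝓝 (c * mass δ fun x => z (max x 0))) :=
    (intervalIntegral_tendsto_integral_Ioi 0
      (integrableOn_density hδ hz.continuous_comp_max hI) tendsto_id).const_mul c
  have h2 : c * mass δ (fun x => z (max x 0)) = 1 := by
    refine tendsto_nhds_unique h1 (hz.solution.at_infty.congr' ?_)
    filter_upwards [eventually_ge_atTop 0] with y hy using hc y hy
  rw [hc _ (le_max_right x 0), linearizedSolution, div_eq_iff hm.ne', mul_right_comm, h2, one_mul]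

end Uniqueness

/-! ### Every fixed point is an analytic solution. -/

section Existence

variable {δ : ℝ} {y : ℝ → ℝ}

theorem isModifiedErrorFunction_of_linearizedSolution_eq (hδ : 0 < δ) (hc : Continuous y)
    (hI : ∀ x, y x ∈ Icc (0 : ℝ) 1) (hfix : linearizedSolution δ y = y) :
    IsModifiedErrorFunction δ y := by
  have h0 : ∀ x, 0 ≤ y x := fun x => (hI x).1
  have hA := one_le_conductivity hδ h0
  have hm := mass_pos hδ hc hI
  have hd : ∀ x, 0 < x → HasDerivAt y (density δ y x / mass δ y) x := by
    intro x hx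
    have h1 := hasDerivAt_linearizedSolution hδ hc hI hx
    rwa [hfix] at h1
  have hw : ∀ x, HasDerivAt (fun t => Real.exp (-potential δ y t) / mass δ y)
      (-2 * (x * (Real.exp (-potential δ y x) / mass δ y) * (1 + δ * y x)⁻¹)) x := by
    intro x
    refine ((hasDerivAt_potential hδ hc h0 x).fun_neg.exp.div_const (mass δ y)).congr_deriv ?_
    ring
  have hflux : ∀ x, 0 < x →
      (1 + δ * y x) * deriv y x = Real.exp (-potential δ y x) / mass δ y := by
    intro x hx
    have hAx := hA x
    rw [(hd x hx).deriv, density]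
    field_simp
  have hfluxd : ∀ x, 0 < x → HasDerivAt (fun t => (1 + δ * y t) * deriv y t)
      (-2 * (x * (Real.exp (-potential δ y x) / mass δ y) * (1 + δ * y x)⁻¹)) x := by
    intro x hx
    refine (hw x).congr_of_eventuallyEq ?_
    filter_upwards [lt_mem_nhds hx] with t ht using hflux t ht
  refine ⟨⟨hc.continuousOn, fun x hx => (hd x hx).differentiableAt,
    fun x hx => (hfluxd x hx).differentiableAt, fun x hx => ?_, ?_, ?_⟩, fun x _ => h0 x, ?_⟩
  · rw [(hfluxd x hx).deriv, (hd x hx).deriv, density]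
    ring
  · rw [← hfix, linearizedSolution_zero]
  · have h1 := tendsto_linearizedSolution hδ hc hI
    rwa [hfix] at h1
  · have hcp := continuous_potential hδ hc h0
    let p : C(ℝ, ℝ) := ⟨fun x => (1 + δ * y x)⁻¹,
      Continuous.inv₀ (by fun_prop) fun x => by linarith [hA x]⟩
    let w : C(ℝ, ℝ) := ⟨fun x => Real.exp (-potential δ y x) / mass δ y, by fun_prop⟩
    have hp : AnalyticOn ℝ p (Ici 0) := by
      refine analyticOn_of_hasDerivAt (δ := δ) (w := w) (fun x hx => ?_) fun x _ => hw x
      have h1 := (((hd x hx).const_mul δ).const_add 1).fun_inv (by linarith [hA x])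
      refine h1.congr_deriv ?_
      change _ = -δ * (Real.exp (-potential δ y x) / mass δ y * (1 + δ * y x)⁻¹ ^ 3)
      have hAx := hA x
      rw [density]
      field_simp
    -- Solving `p = (1 + δ y)⁻¹` for `y` transfers analyticity from `p`.
    have h1 : AnalyticOn ℝ (fun x => δ⁻¹ * ((p x)⁻¹ - 1)) (Ici 0) :=
      analyticOn_const.mul ((hp.inv fun x _ => inv_ne_zero (by linarith [hA x])).sub
        analyticOn_const)
    refine h1.congr fun x _ => ?_
    change y x = δ⁻¹ * ((1 + δ * y x)⁻¹⁻¹ - 1)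
    rw [inv_inv]
    field_simp
    ring

end Existence

/-! ### Banach's fixed point theorem and the conclusion. -/

open BoundedContinuousFunction in
theorem exists_unique_linearizedSolution_eq {δ : ℝ} (hδ : 0 < δ) (hlt : thresholdFun δ < 1) :
    ∃ y : ℝ → ℝ, (Continuous y ∧ (∀ x, y x ∈ Icc (0 : ℝ) 1) ∧ linearizedSolution δ y = y) ∧
      ∀ z : ℝ → ℝ, Continuous z → (∀ x, z x ∈ Icc (0 : ℝ) 1) → linearizedSolution δ z = z →
        z = y := by
  have hT0 : 0 ≤ thresholdFun δ := by
    unfold thresholdFun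
    positivity
  -- A closed subset of a complete space in the sup metric, mapped to itself by the linearized
  -- solution.
  let K : Set (ℝ →ᵇ ℝ) := {h | ∀ x, h x ∈ Icc (0 : ℝ) 1}
  have hK : IsClosed K := by
    have : K = ⋂ x, (fun h : ℝ →ᵇ ℝ => h x) ⁻¹' Icc 0 1 := by ext; simp [K]
    rw [this]
    exact isClosed_iInter fun x => isClosed_Icc.preimage (continuous_eval_const (x := x))
  have : CompleteSpace K := hK.completeSpace_coe
  have : Nonempty K := ⟨⟨0, fun x => by simp⟩⟩
  let toK : ∀ z : ℝ → ℝ, Continuous z → (∀ x, z x ∈ Icc (0 : ℝ) 1) → K := fun z zc zI =>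
    ⟨BoundedContinuousFunction.ofNormedAddCommGroup z zc 1 fun x => by
      rw [Real.norm_of_nonneg (zI x).1]; exact (zI x).2, zI⟩
  let T : K → K := fun h => toK (linearizedSolution δ h.1)
    (continuous_linearizedSolution hδ h.1.continuous h.2)
    (linearizedSolution_mem hδ h.1.continuous h.2)
  have hT : ContractingWith ⟨thresholdFun δ, hT0⟩ T := by
    refine ⟨by exact_mod_cast hlt, LipschitzWith.of_dist_le_mul fun h k => ?_⟩
    change dist (T h).1 (T k).1 ≤ thresholdFun δ * dist h.1 k.1
    rw [BoundedContinuousFunction.dist_le (mul_nonneg hT0 dist_nonneg)]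
    exact abs_linearizedSolution_sub_le hδ h.1.continuous k.1.continuous h.2 k.2 fun x =>
         (Real.dist_eq _ _).symm.trans_le (BoundedContinuousFunction.dist_coe_le_dist x)
  let y := ContractingWith.fixedPoint T hT
  have hy : T y = y := hT.fixedPoint_isFixedPt
  refine ⟨y.1, ⟨y.1.continuous, y.2, ?_⟩, fun z zc zI hz => ?_⟩
  · exact congrArg (fun h : K => (h.1 : ℝ → ℝ)) hy
  · have hz' : T (toK z zc zI) = toK z zc zI := Subtype.ext (DFunLike.coe_injective hz)
    exact congrArg (fun h : K => (h.1 : ℝ → ℝ)) (hT.fixedPoint_unique hz')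

theorem corollary2 :
    ∃ δ₁ : ℝ,
      (0 < δ₁ ∧ thresholdFun δ₁ = 1) ∧
      (∀ x : ℝ, 0 < x → thresholdFun x = 1 → x = δ₁) ∧
      (0.203701 < δ₁ ∧ δ₁ < 0.203702) ∧
      ∀ δ : ℝ, 0 < δ → δ < δ₁ →
        ∃ y : ℝ → ℝ, IsModifiedErrorFunction δ y ∧
          ∀ z : ℝ → ℝ, IsModifiedErrorFunction δ z → Set.EqOn z y (Set.Ici 0) := by
  obtain ⟨d, hd, hlo, hup⟩ := exists_thresholdFun_eq_one
  have hd0 : 0 < d := lt_trans (by norm_num) hlo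
  refine ⟨d, ⟨hd0, hd⟩, fun x hx hx1 => ?_, ⟨hlo, hup⟩, fun δ hδ hδd => ?_⟩
  · exact thresholdFun_strictMonoOn.injOn (mem_Ici.2 hx.le) (mem_Ici.2 hd0.le) (hx1.trans hd.symm)
  have hlt : thresholdFun δ < 1 := by
    rw [← hd]
    exact thresholdFun_strictMonoOn (mem_Ici.2 hδ.le) (mem_Ici.2 hd0.le) hδd
  obtain ⟨y, ⟨yc, yI, hy⟩, huniq⟩ := exists_unique_linearizedSolution_eq hδ hlt
  refine ⟨y, isModifiedErrorFunction_of_linearizedSolution_eq hδ yc yI hy, fun z hz x hx => ?_⟩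
  have h1 := huniq _ hz.continuous_comp_max (hz.comp_max_mem hδ)
    (funext (hz.linearizedSolution_eq hδ))
  have h2 := congrFun h1 x
  rwa [max_eq_left (mem_Ici.1 hx)] at h2
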